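/- Fix constants $\lambda>0$, $w_0>0$, and let $d=d(n)$ be a sequence of dimensions with $d=\omega(\log n)$, i.e. $\log n/d(n)\to 0$. Let $G=G_n$ be the standard geometric inhomogeneous random graph with parameters $n$, $\beta=3$, $w_0$, $d$: each of the $n$ vertices $v$ independently receives a weight $w_v$ with $\Pr[w_v\le x]=1-(x/w_0)^{1-\beta}=1-(x/w_0)^{-2}$ for $x\ge w_0$, and, independently, a position $\mathbf{x}_v$ uniform on the torus $\mathbb{T}^d=(\mathbb{R}/\mathbb{Z})^d$; two distinct vertices $u,v$ are adjacent if and only if their $L_\infty$-distance on the torus (the maximum over the coordinates of the distance on the circle of circumference $1$) is at most $$t_{uv}=\frac12\left(\frac{\lambda w_uw_v}{n}\right)^{1/d}.$$ Let $K_4$ be the number of $4$-cliques (complete subgraphs on four vertices) of $G$, and let $\omega(G)$ be the size of its largest clique. Then: 1. $K_4$ is bounded in probability (tight): for every $\varepsilon>0$ there is a constant $c$ such that $\Pr[K_4\ge c]\le\varepsilon$ for all $n$. 2. Consequently $\omega(G)=\mathcal{O}(1)$ in probability: for every $\varepsilon>0$ there is a constant $c$ such that $\Pr[\omega(G)\ge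 c]\le\varepsilon$ for all $n$. Moreover, for every function $f$ with $f(n)\to\infty$, $\Pr[\omega(G)\ge f(n)]\to 0$ as $n\to\infty$. -/

import Mathlib

open MeasureTheory ProbabilityTheory Filter Topology Asymptotics

noncomputable section

/-- A vertex sample: its weight and its position on the `d`-dimensional torus.
The metric on `UnitAddTorus (Fin d)` is the `L_∞` metric, i.e. the maximum over the coordinates of
the distance on the circle of circumference `1`. -/
abbrev VertexSample (d : ℕ) : Type := ℝ × UnitAddTorus (Fin d)

/-- The law of one vertex: the weight is Pareto distributed with
`P(w ≤ x) = 1 - (x / w₀) ^ (1 - β)` for `x ≥ w₀`, and, independently of it, the position is uniform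
on the torus. -/
def vertexLaw (β w₀ : ℝ) (d : ℕ) : Measure (VertexSample d) :=
  (paretoMeasure w₀ (β - 1)).prod (volume : Measure (UnitAddTorus (Fin d)))

/-- The joint law of `n` independent vertices. -/
def sampleLaw (n : ℕ) (β w₀ : ℝ) (d : ℕ) : Measure (Fin n → VertexSample d) :=
  Measure.pi fun _ => vertexLaw β w₀ d

theorem isProbabilityMeasure_sampleLaw (n : ℕ) {β w₀ : ℝ} (hβ : 1 < β) (hw₀ : 0 < w₀) (d : ℕ) :
    IsProbabilityMeasure (sampleLaw n β w₀ d) := by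
  have := isProbabilityMeasure_paretoMeasure hw₀ (sub_pos.mpr hβ)
  have : IsProbabilityMeasure (volume : Measure UnitAddCircle) := ⟨UnitAddCircle.measure_univ⟩
  have : IsProbabilityMeasure (volume : Measure (UnitAddTorus (Fin d))) := by
    rw [volume_pi]
    infer_instance
  unfold sampleLaw vertexLaw
  infer_instance

/-- The connection threshold `t_{uv} = (1/2) (λ w_u w_v / n)^(1/d)`. -/
def connectionThreshold (n d : ℕ) (lam wu wv : ℝ) : ℝ :=
  (1 / 2) * (lam * wu * wv / (n : ℝ)) ^ (1 / (d : ℝ))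

/-- The standard geometric inhomogeneous random graph as a function of the sampled weights and
positions: distinct vertices are adjacent iff their torus distance is at most the connection
threshold. Its law is obtained by drawing the samples from `sampleLaw n β w₀ d`. -/
def girg (n d : ℕ) (lam : ℝ) (x : Fin n → VertexSample d) : SimpleGraph (Fin n) where
  Adj u v := u ≠ v ∧ dist (x u).2 (x v).2 ≤ connectionThreshold n d lam (x u).1 (x v).1
  symm := ⟨fun u v h => ⟨h.1.symm, by
    have h2 := h.2
    rw [dist_comm]
    unfold connectionThreshold at h2 ⊢
    rwa [mul_right_comm lam]⟩⟩
  loopless := ⟨fun _ h => h.1 rfl⟩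

/-- The number `K_k` of `k`-cliques of a graph. -/
def cliqueCount {V : Type*} (G : SimpleGraph V) (k : ℕ) : ℕ := (G.cliqueSet k).ncard

end

/-!
In a single coordinate of the torus, the events that the two endpoints of an edge are far apart are
pairwise independent: conditionally on everything else, one endpoint of the second edge is still
uniform. The second moment method therefore bounds the probability that no edge of a 4-clique is
violated in this coordinate by `1 / (1 + ∑ e, (1 - κ e ^ (1 / d)))`, where `κ e` is the minimum of
`1` and `λ w_u w_v / n`. The coordinates are independent, so taking the `d`-th power gives
`∏ e, κ e ^ γ`, where `γ` exceeds `2 / 3` once `log n / d` is small, and tends to `1`, the value for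
independent edges, as `log n / d` tends to `0`.

With `γ = 2 / 3 + η`, this product over the edges is at most a product over the four vertices of
`min (u ^ (2 - η)) (u ^ (2 + η))`, where `u = √(λ / n) w`. Under a Pareto law of exponent `β ≥ 3`
each factor has mean `O(1 / n)`, so four given vertices form a clique with probability `O(n⁻⁴)` and
the expected number of 4-cliques is `O(1)`. Markov's inequality gives tightness of `K₄`, and a
clique of size `m` contains `m.choose 4 ≥ m - 3` cliques of size four.
-/

theorem indepFun_indicator_one_of_indepSet {Ω : Type*} [MeasurableSpace Ω] {μ : Measure Ω}
    {A B : Set Ω} (h : IndepSet A B μ) :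
    IndepFun (A.indicator fun _ => (1 : ℝ)) (B.indicator fun _ => (1 : ℝ)) μ := by
  refine Indep.indicator_indepFun (m := MeasurableSpace.generateFrom {A}) 1
    (MeasurableSpace.measurableSet_generateFrom rfl)
    (indep_of_indep_of_le_right ((IndepSet_iff_Indep A B μ).mp h) (Measurable.comap_le ?_))
  exact Measurable.indicator (m := MeasurableSpace.generateFrom {B}) measurable_const
    (MeasurableSpace.measurableSet_generateFrom rfl)

theorem variance_indicator_one_le {Ω : Type*} [MeasurableSpace Ω] {μ : Measure Ω}
    [IsProbabilityMeasure μ] {A : Set Ω} (hA : MeasurableSet A) :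
    Var[A.indicator fun _ => (1 : ℝ); μ] ≤ μ.real A := by
  refine (variance_le_expectation_sq (aestronglyMeasurable_const.indicator hA)).trans_eq ?_
  rw [← integral_indicator_one hA]
  congr 1
  ext ω
  by_cases hω : ω ∈ A <;> simp [hω]

theorem measureReal_eq_zero_le_inv_one_add_integral {Ω : Type*} [MeasurableSpace Ω]
    {μ : Measure Ω} [IsProbabilityMeasure μ] {N : Ω → ℝ} (hN : MemLp N 2 μ)
    (hvar : Var[N; μ] ≤ μ[N]) : μ.real {ω | N ω = 0} ≤ (1 + μ[N])⁻¹ := by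
  have hpos : 0 < 1 + μ[N] := by linarith [variance_nonneg N μ]
  -- `c` minimises the second moment of `1 - c * N`, a variable equal to `1` when `N` vanishes.
  let c := (1 + μ[N])⁻¹
  let Y : Ω → ℝ := fun ω => 1 - c * N ω
  have hY : MemLp Y 2 μ := (memLp_const 1).sub (hN.const_mul c)
  have hYmean : μ[Y] = 1 - c * μ[N] := by
    rw [integral_sub (integrable_const 1) ((hN.integrable one_le_two).const_mul c),
      integral_const_mul, integral_const, probReal_univ, one_smul]
  have hYvar : Var[Y; μ] = c ^ 2 * Var[N; μ] := by
    rw [variance_const_sub (hN.aestronglyMeasurable.const_mul c), variance_const_mul]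
  calc μ.real {ω | N ω = 0} ≤ μ.real {ω | 1 ≤ Y ω ^ 2} :=
        measureReal_mono fun ω hω => by simp [Y, show N ω = 0 from hω]
    _ ≤ μ[Y ^ 2] := by
      simpa using mul_meas_ge_le_integral_of_nonneg (ae_of_all _ fun ω => sq_nonneg (Y ω))
        hY.integrable_sq 1
    _ = c ^ 2 * Var[N; μ] + (1 - c * μ[N]) ^ 2 := by
      rw [← hYvar, variance_eq_sub hY, hYmean, sub_add_cancel]
    _ ≤ c ^ 2 * μ[N] + (1 - c * μ[N]) ^ 2 := by gcongr
    _ = (1 + μ[N])⁻¹ := by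
      simp only [c]
      field_simp
      ring

theorem measureReal_biInter_compl_le_of_pairwise_indepSet {Ω ι : Type*} [MeasurableSpace Ω]
    {μ : Measure Ω} [IsProbabilityMeasure μ] {s : Finset ι} {F : ι → Set Ω}
    (hF : ∀ i ∈ s, MeasurableSet (F i))
    (hind : (s : Set ι).Pairwise fun i j => IndepSet (F i) (F j) μ) :
    μ.real (⋂ i ∈ s, (F i)ᶜ) ≤ (1 + ∑ i ∈ s, μ.real (F i))⁻¹ := by
  have hMemLp (i) (hi : i ∈ s) : MemLp ((F i).indicator fun _ => (1 : ℝ)) 2 μ :=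
    memLp_indicator_const 2 (hF i hi) 1 (Or.inr (measure_ne_top μ _))
  let N : Ω → ℝ := ∑ i ∈ s, (F i).indicator fun _ => 1
  have hmean : μ[N] = ∑ i ∈ s, μ.real (F i) := by
    simp only [N, Finset.sum_apply]
    rw [integral_finsetSum s fun i hi => (hMemLp i hi).integrable one_le_two]
    exact Finset.sum_congr rfl fun i hi => integral_indicator_one (hF i hi)
  have hvar : Var[N; μ] ≤ μ[N] := by
    rw [hmean, IndepFun.variance_sum hMemLp fun i hi j hj hij =>
      indepFun_indicator_one_of_indepSet (hind hi hj hij)]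
    exact Finset.sum_le_sum fun i hi => variance_indicator_one_le (hF i hi)
  rw [← hmean]
  refine (measureReal_mono fun ω hω => ?_).trans
    (measureReal_eq_zero_le_inv_one_add_integral (memLp_finsetSum' s hMemLp) hvar)
  simp only [Set.mem_ofPred_eq, N, Finset.sum_apply]
  exact Finset.sum_eq_zero fun i hi =>
    Set.indicator_of_notMem (Set.mem_iInter₂.mp hω i hi) _

section ProductMeasure

theorem lintegral_pi_lintegral_update {ι : Type*} [Fintype ι] [DecidableEq ι] {X : ι → Type*}
    [∀ i, MeasurableSpace (X i)] (μ : ∀ i, Measure (X i)) [∀ i, IsProbabilityMeasure (μ i)]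
    (s : ι) {f : (∀ i, X i) → ENNReal} (hf : Measurable f) :
    ∫⁻ x, ∫⁻ z, f (Function.update x s z) ∂μ s ∂Measure.pi μ = ∫⁻ x, f x ∂Measure.pi μ := by
  have hmarginal : Measurable fun x => ∫⁻ z, f (Function.update x s z) ∂μ s := by
    rw [← lmarginal_singleton]
    exact hf.lmarginal μ
  refine lintegral_eq_of_lmarginal_eq {s} hmarginal hf ?_
  simp only [lmarginal_singleton, Function.update_idem, lintegral_const, measure_univ, mul_one]

variable {ι κ X : Type*} [Fintype ι] [Fintype κ] [MeasurableSpace X] (μ : Measure X)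
  [IsProbabilityMeasure μ]

theorem measure_pi_inter_eq_mul [DecidableEq ι] {r s : ι} (hrs : r ≠ s)
    {A : Set (ι → X)} (hA : MeasurableSet A) (hAs : ∀ x z, Function.update x s z ∈ A ↔ x ∈ A)
    {B : Set (X × X)} (hB : MeasurableSet B) {p : ENNReal} (hp : ∀ x, μ {z | (x, z) ∈ B} = p) :
    (Measure.pi fun _ => μ) (A ∩ {x | (x r, x s) ∈ B}) = (Measure.pi fun _ => μ) A * p := by
  have hB' : MeasurableSet {x : ι → X | (x r, x s) ∈ B} :=
    hB.preimage (by fun_prop : Measurable fun x : ι → X => (x r, x s))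
  have hsection (x : ι → X) : ∫⁻ z, (A ∩ {x | (x r, x s) ∈ B}).indicator 1
      (Function.update x s z) ∂μ = A.indicator (fun _ => p) x := by
    have hcomp : (fun z => (A ∩ {x | (x r, x s) ∈ B}).indicator (1 : (ι → X) → ENNReal)
        (Function.update x s z)) = {z | x ∈ A ∧ (x r, z) ∈ B}.indicator 1 := by
      classical
      ext z
      simp [Set.indicator_apply, hAs, Function.update_of_ne hrs]
    have hmeas : MeasurableSet {z | x ∈ A ∧ (x r, z) ∈ B} :=
      (MeasurableSet.const _).inter (measurable_prodMk_left hB)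
    rw [hcomp, lintegral_indicator_one hmeas]
    by_cases hx : x ∈ A <;> simp [hx, hp]
  rw [← lintegral_indicator_one (hA.inter hB'), ← lintegral_pi_lintegral_update (fun _ => μ) s
    (measurable_one.indicator (hA.inter hB'))]
  rw [lintegral_congr hsection, lintegral_indicator_const hA, mul_comm]

theorem measure_pi_eq_of_forall_measure_section_eq {r s : ι} (hrs : r ≠ s)
    {B : Set (X × X)} (hB : MeasurableSet B) {p : ENNReal} (hp : ∀ x, μ {z | (x, z) ∈ B} = p) :
    (Measure.pi fun _ => μ) {x : ι → X | (x r, x s) ∈ B} = p := by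
  classical
  simpa using measure_pi_inter_eq_mul μ hrs MeasurableSet.univ (by simp) hB hp

theorem indepSet_pi_of_forall_measure_section_eq [DecidableEq ι] {r s : ι} (hrs : r ≠ s)
    {A : Set (ι → X)} (hA : MeasurableSet A) (hAs : ∀ x z, Function.update x s z ∈ A ↔ x ∈ A)
    {B : Set (X × X)} (hB : MeasurableSet B) {p : ENNReal} (hp : ∀ x, μ {z | (x, z) ∈ B} = p) :
    IndepSet A {x | (x r, x s) ∈ B} (Measure.pi fun _ => μ) := by
  have hB' : MeasurableSet {x : ι → X | (x r, x s) ∈ B} :=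
    hB.preimage (by fun_prop : Measurable fun x : ι → X => (x r, x s))
  refine (indepSet_iff_measure_inter_eq_mul hA hB' _).mpr ?_
  rw [measure_pi_inter_eq_mul μ hrs hA hAs hB hp,
    measure_pi_eq_of_forall_measure_section_eq μ hrs hB hp]

theorem measurePreserving_pi_precomp {e : κ → ι} (he : Function.Injective e) :
    MeasurePreserving (fun (x : ι → X) k => x (e k)) (Measure.pi fun _ => μ)
      (Measure.pi fun _ => μ) := by
  refine ⟨by fun_prop, ?_⟩
  have h := (iIndepFun_pi (μ := fun _ : ι => μ) (X := fun _ x => x)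
    fun _ => aemeasurable_id).precomp he
  rw [iIndepFun_iff_map_fun_eq_pi_map fun k => (measurable_pi_apply _).aemeasurable] at h
  rw [h]
  congr 1
  funext k
  exact (measurePreserving_eval (fun _ : ι => μ) (e k)).map_eq

theorem measurePreserving_pi_swap :
    MeasurePreserving (fun (x : ι → κ → X) k i => x i k)
      (Measure.pi fun _ => Measure.pi fun _ => μ) (Measure.pi fun _ => Measure.pi fun _ => μ) := by
  refine ⟨by fun_prop, ?_⟩
  have hικ := Measure.infinitePi_map_curry fun (_ : ι) (_ : κ) => μ
  have hκι := Measure.infinitePi_map_curry fun (_ : κ) (_ : ι) => μ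
  simp only [Measure.infinitePi_eq_pi] at hικ hκι
  rw [← hικ, ← hκι, Measure.map_map (by fun_prop) (MeasurableEquiv.measurable _),
    ← (measurePreserving_pi_precomp μ (Prod.swap_injective (α := κ) (β := ι))).map_eq,
    Measure.map_map (MeasurableEquiv.measurable _) (by fun_prop)]
  rfl

theorem measure_pi_pi_forall_mem {A : Set (ι → X)} (hA : MeasurableSet A) :
    (Measure.pi fun _ : ι => Measure.pi fun _ : κ => μ) {x | ∀ k, (fun i => x i k) ∈ A} =
      (Measure.pi fun _ => μ) A ^ Fintype.card κ := by
  have hpreimage : {x : ι → κ → X | ∀ k, (fun i => x i k) ∈ A} =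
      (fun (x : ι → κ → X) k i => x i k) ⁻¹' Set.univ.pi fun _ => A := by
    ext x
    simp
  rw [hpreimage, (measurePreserving_pi_swap μ).measure_preimage
    (MeasurableSet.univ_pi fun _ => hA).nullMeasurableSet, Measure.pi_pi, Finset.prod_const,
    Finset.card_univ]

theorem lintegral_pi_prod_eq_pow_card {g : X → ENNReal} (hg : Measurable g) :
    ∫⁻ x : ι → X, ∏ i, g (x i) ∂(Measure.pi fun _ => μ) = (∫⁻ x, g x ∂μ) ^ Fintype.card ι := by
  have hind := iIndepFun_pi (μ := fun _ : ι => μ) (X := fun _ => g) fun _ => hg.aemeasurable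
  rw [lintegral_prod_eq_prod_lintegral_of_indepFun Finset.univ _ hind
    fun i => hg.comp (measurable_pi_apply i)]
  have hmarginal (i : ι) : ∫⁻ x : ι → X, g (x i) ∂(Measure.pi fun _ => μ) = ∫⁻ x, g x ∂μ :=
    (measurePreserving_eval (fun _ : ι => μ) i).lintegral_comp hg
  simp [hmarginal]

end ProductMeasure

theorem isProbabilityMeasure_volume_unitAddCircle :
    IsProbabilityMeasure (volume : Measure UnitAddCircle) := ⟨UnitAddCircle.measure_univ⟩

attribute [local instance] isProbabilityMeasure_volume_unitAddCircle

section Torus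

theorem volume_lt_dist_unitAddCircle (x : UnitAddCircle) {t : ℝ} (ht : 0 ≤ t) :
    volume {y : UnitAddCircle | t < dist x y} = ENNReal.ofReal (1 - min 1 (2 * t)) := by
  have hball : {y : UnitAddCircle | t < dist x y} = (Metric.closedBall x t)ᶜ := by
    ext y
    simp [dist_comm]
  rw [hball, prob_compl_eq_one_sub Metric.isClosed_closedBall.measurableSet,
    AddCircle.volume_closedBall, ENNReal.ofReal_sub 1 (by positivity), ENNReal.ofReal_one]

variable {V : Type*} [Fintype V]

theorem measurableSet_lt_dist_unitAddCircle (t : ℝ) :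
    MeasurableSet {p : UnitAddCircle × UnitAddCircle | t < dist p.1 p.2} :=
  measurableSet_lt measurable_const (measurable_fst.dist measurable_snd)

theorem measureReal_pi_lt_dist_unitAddCircle {r s : V} (hrs : r ≠ s) {t : ℝ} (ht : 0 ≤ t) :
    volume.real {y : V → UnitAddCircle | t < dist (y r) (y s)} = 1 - min 1 (2 * t) := by
  have hvolume : volume {y : V → UnitAddCircle | t < dist (y r) (y s)} =
      ENNReal.ofReal (1 - min 1 (2 * t)) :=
    measure_pi_eq_of_forall_measure_section_eq volume hrs
      (measurableSet_lt_dist_unitAddCircle t) fun x => volume_lt_dist_unitAddCircle x ht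
  rw [measureReal_def, hvolume, ENNReal.toReal_ofReal (sub_nonneg.mpr (min_le_left _ _))]

theorem indepSet_lt_dist_unitAddCircle_of_ne {a b r s : V} (hrs : r ≠ s) (has : a ≠ s)
    (hbs : b ≠ s) (t : ℝ) {t' : ℝ} (ht' : 0 ≤ t') :
    IndepSet {y : V → UnitAddCircle | t < dist (y a) (y b)} {y | t' < dist (y r) (y s)}
      volume := by
  classical
  rw [volume_pi]
  refine indepSet_pi_of_forall_measure_section_eq volume hrs
    (measurableSet_lt measurable_const ((measurable_pi_apply a).dist (measurable_pi_apply b)))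
    (fun y z => ?_) (measurableSet_lt_dist_unitAddCircle t')
    fun x => volume_lt_dist_unitAddCircle x ht'
  simp only [Set.mem_ofPred_eq, Function.update_of_ne has, Function.update_of_ne hbs]

theorem pairwise_indepSet_lt_dist_unitAddCircle [LinearOrder V] {E : Finset (V × V)}
    (hE : ∀ e ∈ E, e.1 < e.2) {t : V × V → ℝ} (ht : ∀ e ∈ E, 0 ≤ t e) :
    (E : Set (V × V)).Pairwise fun e f => IndepSet
      {y : V → UnitAddCircle | t e < dist (y e.1) (y e.2)} {y | t f < dist (y f.1) (y f.2)}
      volume := by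
  rintro ⟨a, b⟩ he ⟨r, s⟩ hf hef
  have hab : a < b := hE _ he
  have hrs : r < s := hE _ hf
  by_cases hs : a ≠ s ∧ b ≠ s
  · exact indepSet_lt_dist_unitAddCircle_of_ne hrs.ne hs.1 hs.2 _ (ht _ hf)
  -- Some endpoint of the second edge avoids the first one; if it is not `s`, it is `r`.
  · have hr : a ≠ r ∧ b ≠ r := by grind
    simpa only [dist_comm] using
      indepSet_lt_dist_unitAddCircle_of_ne hrs.ne' hr.1 hr.2 (t (a, b)) (ht _ hf)

theorem measureReal_pi_forall_dist_le_unitAddCircle_le [LinearOrder V] {E : Finset (V × V)}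
    (hE : ∀ e ∈ E, e.1 < e.2) {t : V × V → ℝ} (ht : ∀ e ∈ E, 0 ≤ t e) :
    volume.real {y : V → UnitAddCircle | ∀ e ∈ E, dist (y e.1) (y e.2) ≤ t e} ≤
      (1 + ∑ e ∈ E, (1 - min 1 (2 * t e)))⁻¹ := by
  have hcompl : {y : V → UnitAddCircle | ∀ e ∈ E, dist (y e.1) (y e.2) ≤ t e} =
      ⋂ e ∈ E, {y | t e < dist (y e.1) (y e.2)}ᶜ := by
    ext y
    simp
  rw [hcompl, ← Finset.sum_congr rfl fun e he =>
    measureReal_pi_lt_dist_unitAddCircle (hE e he).ne (ht e he)]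
  refine measureReal_biInter_compl_le_of_pairwise_indepSet (fun e _ => ?_)
    (pairwise_indepSet_lt_dist_unitAddCircle hE ht)
  exact measurableSet_lt measurable_const
    ((measurable_pi_apply e.1).dist (measurable_pi_apply e.2))

theorem volume_pi_forall_dist_le_unitAddTorus_le [LinearOrder V] (d : ℕ) {E : Finset (V × V)}
    (hE : ∀ e ∈ E, e.1 < e.2) {t : V × V → ℝ} (ht : ∀ e ∈ E, 0 ≤ t e) :
    volume {x : V → UnitAddTorus (Fin d) | ∀ e ∈ E, dist (x e.1) (x e.2) ≤ t e} ≤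
      ENNReal.ofReal ((1 + ∑ e ∈ E, (1 - min 1 (2 * t e)))⁻¹ ^ d) := by
  let A := {y : V → UnitAddCircle | ∀ e ∈ E, dist (y e.1) (y e.2) ≤ t e}
  have hA : MeasurableSet A := by
    have hinter : A = ⋂ e ∈ E, {y | dist (y e.1) (y e.2) ≤ t e} := by
      ext y
      simp [A]
    rw [hinter]
    exact Finset.measurableSet_biInter E fun e _ => measurableSet_le
      ((measurable_pi_apply e.1).dist (measurable_pi_apply e.2)) measurable_const
  have hcoord : {x : V → UnitAddTorus (Fin d) | ∀ e ∈ E, dist (x e.1) (x e.2) ≤ t e} =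
      {x | ∀ k, (fun i => x i k) ∈ A} := by
    ext x
    exact ⟨fun h k e he => (dist_pi_le_iff (ht e he)).mp (h e he) k,
      fun h e he => (dist_pi_le_iff (ht e he)).mpr fun k => h k e he⟩
  have hpow : volume {x : V → UnitAddTorus (Fin d) | ∀ k, (fun i => x i k) ∈ A} =
      volume A ^ d := by
    simpa only [volume_pi, Fintype.card_fin] using
      measure_pi_pi_forall_mem (κ := Fin d) (volume : Measure UnitAddCircle) hA
  rw [hcoord, hpow, ← ofReal_measureReal, ← ENNReal.ofReal_pow measureReal_nonneg]
  exact ENNReal.ofReal_le_ofReal (pow_le_pow_left₀ measureReal_nonneg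
    (measureReal_pi_forall_dist_le_unitAddCircle_le hE ht) d)

end Torus
theorem div_one_add_le_one_sub_exp_neg {δ l : ℝ} (hl : 0 ≤ l) (hlδ : l ≤ δ) :
    l / (1 + δ) ≤ 1 - Real.exp (-l) := by
  have hexp : Real.exp (-l) ≤ (1 + l)⁻¹ := by
    rw [Real.exp_neg]
    exact inv_anti₀ (by linarith) (by linarith [Real.add_one_le_exp l])
  calc l / (1 + δ) ≤ l / (1 + l) := by gcongr
    _ = 1 - (1 + l)⁻¹ := by
      field_simp
      ring
    _ ≤ 1 - Real.exp (-l) := by linarith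

theorem inv_one_add_sum_one_sub_exp_neg_le {ι : Type*} {s : Finset ι} {l : ι → ℝ} {γ δ : ℝ}
    (hδ : 0 ≤ δ) (hl : ∀ i ∈ s, 0 ≤ l i) (hlδ : ∀ i ∈ s, l i ≤ δ)
    (hγ : γ * (1 + (s.card + 1) * δ) ≤ 1) :
    (1 + ∑ i ∈ s, (1 - Real.exp (-l i)))⁻¹ ≤ Real.exp (-(γ * ∑ i ∈ s, l i)) := by
  set L := ∑ i ∈ s, l i
  set D := 1 + (s.card + 1) * δ with hD
  have hL : 0 ≤ L := Finset.sum_nonneg hl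
  have hLD : 1 + δ ≤ D - L := by
    have : L ≤ s.card * δ := by simpa using Finset.sum_le_card_nsmul s l δ hlδ
    linarith
  have hDpos : 0 < D := by linarith
  rw [Real.exp_neg]
  refine inv_anti₀ (Real.exp_pos _) ?_
  calc Real.exp (γ * L) ≤ Real.exp (L / D) := by
        rw [Real.exp_le_exp, le_div_iff₀ hDpos, mul_right_comm]
        exact mul_le_of_le_one_left hL hγ
    _ ≤ 1 / (1 - L / D) := Real.exp_bound_div_one_sub_of_interval (by positivity)
      ((div_lt_one hDpos).mpr (by linarith))
    _ = 1 + L / (D - L) := by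
      have hne : D - L ≠ 0 := by linarith
      field_simp
      ring
    _ ≤ 1 + L / (1 + δ) := by gcongr
    _ ≤ 1 + ∑ i ∈ s, (1 - Real.exp (-l i)) := by
      rw [Finset.sum_div]
      gcongr with i hi
      exact div_one_add_le_one_sub_exp_neg (hl i hi) (hlδ i hi)

theorem min_one_rpow {κ a : ℝ} (hκ : 0 ≤ κ) (ha : 0 ≤ a) : min 1 (κ ^ a) = min 1 κ ^ a := by
  rw [(Real.monotoneOn_rpow_Ici_of_exponent_nonneg ha).map_min (Set.mem_Ici.mpr zero_le_one)
    (Set.mem_Ici.mpr hκ), Real.one_rpow]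

-- With independent edges the exponent would be `1`; `γ` is what pairwise independence retains.
theorem volume_pi_forall_dist_le_half_rpow_le {V : Type*} [Fintype V] [LinearOrder V] {d : ℕ}
    (hd : d ≠ 0) {E : Finset (V × V)} (hE : ∀ e ∈ E, e.1 < e.2) {κ : V × V → ℝ} {γ δ : ℝ}
    (hκ : ∀ e ∈ E, 0 < κ e) (hδ : 0 ≤ δ) (hκδ : ∀ e ∈ E, -Real.log (κ e) ≤ δ * d)
    (hγ : γ * (1 + (E.card + 1) * δ) ≤ 1) :
    volume {x : V → UnitAddTorus (Fin d) |
        ∀ e ∈ E, dist (x e.1) (x e.2) ≤ 1 / 2 * κ e ^ (1 / (d : ℝ))} ≤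
      ENNReal.ofReal (∏ e ∈ E, min 1 (κ e) ^ γ) := by
  have hd' : (0 : ℝ) < d := by positivity
  have hmin (e) (he : e ∈ E) : 0 < min 1 (κ e) := lt_min one_pos (hκ e he)
  let l : V × V → ℝ := fun e => -Real.log (min 1 (κ e)) / d
  have hl (e) (he : e ∈ E) : 0 ≤ l e :=
    div_nonneg (neg_nonneg.mpr (Real.log_nonpos (hmin e he).le (min_le_left _ _))) hd'.le
  have hlδ (e) (he : e ∈ E) : l e ≤ δ := by
    rw [div_le_iff₀ hd']
    rcases min_choice 1 (κ e) with h | h <;> rw [h]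
    · simpa using by positivity
    · exact hκδ e he
  have hthreshold (e) (he : e ∈ E) :
      1 - min 1 (2 * (1 / 2 * κ e ^ (1 / (d : ℝ)))) = 1 - Real.exp (-l e) := by
    rw [← mul_assoc, mul_one_div_cancel two_ne_zero, one_mul, min_one_rpow (hκ e he).le
      (by positivity), Real.rpow_def_of_pos (hmin e he), ← neg_div, neg_neg, mul_one_div]
  have hexp : Real.exp (-(γ * ∑ e ∈ E, l e)) ^ d = ∏ e ∈ E, min 1 (κ e) ^ γ := by
    rw [Finset.prod_congr rfl fun e he => Real.rpow_def_of_pos (hmin e he) γ, ← Real.exp_sum,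
      ← Real.exp_nat_mul, ← Finset.sum_div, ← Finset.sum_mul, Finset.sum_neg_distrib]
    congr 1
    field_simp
  refine (volume_pi_forall_dist_le_unitAddTorus_le d hE fun e he => ?_).trans ?_
  · have := (hκ e he).le
    positivity
  · rw [Finset.sum_congr rfl hthreshold, ← hexp]
    have hsum : 0 ≤ ∑ e ∈ E, (1 - Real.exp (-l e)) := Finset.sum_nonneg fun e he =>
      sub_nonneg.mpr (Real.exp_le_one_iff.mpr (neg_nonpos.mpr (hl e he)))
    exact ENNReal.ofReal_le_ofReal (pow_le_pow_left₀ (by positivity)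
      (inv_one_add_sum_one_sub_exp_neg_le hδ hl hlδ hγ) d)

/-- The edges of the complete graph on `Fin k`, each listed once as the pair of its endpoints in
increasing order. -/
def edgePairs (k : ℕ) : Finset (Fin k × Fin k) := {e | e.1 < e.2}

theorem mem_edgePairs {k : ℕ} {e : Fin k × Fin k} : e ∈ edgePairs k ↔ e.1 < e.2 := by
  simp [edgePairs]

theorem sum_edgePairs_four (f : Fin 4 × Fin 4 → ℝ) :
    ∑ e ∈ edgePairs 4, f e =
      f (0, 1) + f (0, 2) + f (0, 3) + f (1, 2) + f (1, 3) + f (2, 3) := by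
  have hedges : edgePairs 4 = {(0, 1), (0, 2), (0, 3), (1, 2), (1, 3), (2, 3)} := by decide
  simp [hedges, add_assoc]

theorem sum_abs_le_sum_edgePairs_four_abs_add (y : Fin 4 → ℝ) :
    ∑ i, |y i| ≤ ∑ e ∈ edgePairs 4, |y e.1 + y e.2| := by
  have htriangle (a b c : ℝ) : 2 * |a| ≤ |a + b| + |a + c| + |b + c| :=
    calc 2 * |a| = |(a + b) + (a + c) - (b + c)| := by
          rw [← abs_two, ← abs_mul]
          ring_nf
      _ ≤ |(a + b) + (a + c)| + |b + c| := abs_sub _ _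
      _ ≤ |a + b| + |a + c| + |b + c| := by gcongr; exact abs_add_le _ _
  rw [Fin.sum_univ_four, sum_edgePairs_four]
  have h₀ := htriangle (y 0) (y 1) (y 2)
  have h₁ := htriangle (y 1) (y 2) (y 3)
  have h₂ := htriangle (y 2) (y 3) (y 0)
  have h₃ := htriangle (y 3) (y 0) (y 1)
  simp only [add_comm (y 2) (y 0), add_comm (y 3) (y 0), add_comm (y 3) (y 1)] at h₀ h₁ h₂ h₃
  linarith

theorem mul_sum_edgePairs_four_min_zero_le {η : ℝ} (hη : 0 ≤ η) (hη' : η ≤ 2 / 3)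
    (y : Fin 4 → ℝ) :
    (2 / 3 + η) * ∑ e ∈ edgePairs 4, min 0 (y e.1 + y e.2) ≤ ∑ i, (2 * y i - η * |y i|) := by
  have hmin (s : ℝ) : (2 / 3 + η) * min 0 s ≤ 2 / 3 * s - η * |s| := by
    rcases le_total 0 s with hs | hs
    · rw [min_eq_left hs, abs_of_nonneg hs]
      nlinarith
    · rw [min_eq_right hs, abs_of_nonpos hs]
      linarith
  have hdegree : 2 / 3 * ∑ e ∈ edgePairs 4, (y e.1 + y e.2) = ∑ i, 2 * y i := by
    rw [sum_edgePairs_four, Fin.sum_univ_four]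
    ring
  calc (2 / 3 + η) * ∑ e ∈ edgePairs 4, min 0 (y e.1 + y e.2)
      ≤ ∑ e ∈ edgePairs 4, (2 / 3 * (y e.1 + y e.2) - η * |y e.1 + y e.2|) := by
        rw [Finset.mul_sum]
        exact Finset.sum_le_sum fun e _ => hmin _
    _ = ∑ i, 2 * y i - η * ∑ e ∈ edgePairs 4, |y e.1 + y e.2| := by
      rw [Finset.sum_sub_distrib, ← Finset.mul_sum, ← Finset.mul_sum, hdegree]
    _ ≤ ∑ i, 2 * y i - η * ∑ i, |y i| := by
      gcongr
      exact sum_abs_le_sum_edgePairs_four_abs_add y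
    _ = ∑ i, (2 * y i - η * |y i|) := by rw [Finset.mul_sum, Finset.sum_sub_distrib]

theorem min_rpow_sub_rpow_add {u s η : ℝ} (hu : 0 < u) (hη : 0 ≤ η) :
    min (u ^ (s - η)) (u ^ (s + η)) = Real.exp (s * Real.log u - η * |Real.log u|) := by
  rw [Real.rpow_def_of_pos hu, Real.rpow_def_of_pos hu, ← Real.exp_monotone.map_min]
  congr 1
  rcases le_total 0 (Real.log u) with hlog | hlog
  · rw [abs_of_nonneg hlog, min_eq_left (by gcongr; linarith)]
    ring
  · rw [abs_of_nonpos hlog, min_eq_right (mul_le_mul_of_nonpos_left (by linarith) hlog)]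
    ring

theorem prod_edgePairs_four_min_one_rpow_le {η : ℝ} (hη : 0 ≤ η) (hη' : η ≤ 2 / 3)
    {u : Fin 4 → ℝ} (hu : ∀ i, 0 < u i) :
    ∏ e ∈ edgePairs 4, min 1 (u e.1 * u e.2) ^ (2 / 3 + η) ≤
      ∏ i, min (u i ^ (2 - η)) (u i ^ (2 + η)) := by
  have hedge (e : Fin 4 × Fin 4) : min 1 (u e.1 * u e.2) ^ (2 / 3 + η) =
      Real.exp ((2 / 3 + η) * min 0 (Real.log (u e.1) + Real.log (u e.2))) := by
    rw [mul_comm (2 / 3 + η), Real.exp_mul, Real.exp_monotone.map_min, Real.exp_zero, Real.exp_add,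
      Real.exp_log (hu _), Real.exp_log (hu _)]
  simp only [hedge, min_rpow_sub_rpow_add (hu _) hη, ← Real.exp_sum, ← Finset.mul_sum]
  exact Real.exp_le_exp.mpr (mul_sum_edgePairs_four_min_zero_le hη hη' fun i => Real.log (u i))

section Pareto

theorem lintegral_Ioc_rpow_sub_one {c η : ℝ} (hc : 0 ≤ c) (hη : 0 < η) :
    ∫⁻ w in Set.Ioc 0 c, ENNReal.ofReal (w ^ (η - 1)) = ENNReal.ofReal (c ^ η / η) := by
  have hint : IntegrableOn (fun w : ℝ => w ^ (η - 1)) (Set.Ioc 0 c) := by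
    rw [← intervalIntegrable_iff_integrableOn_Ioc_of_le hc]
    exact intervalIntegral.intervalIntegrable_rpow' (by linarith)
  rw [← ofReal_integral_eq_lintegral_ofReal hint, ← intervalIntegral.integral_of_le hc,
    integral_rpow (Or.inl (by linarith)), sub_add_cancel, Real.zero_rpow hη.ne', sub_zero]
  filter_upwards [ae_restrict_mem measurableSet_Ioc] with w hw
  exact Real.rpow_nonneg hw.1.le _

theorem lintegral_Ioi_rpow_neg_sub_one {c η : ℝ} (hc : 0 < c) (hη : 0 < η) :
    ∫⁻ w in Set.Ioi c, ENNReal.ofReal (w ^ (-η - 1)) = ENNReal.ofReal (c ^ (-η) / η) := by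
  have hint : IntegrableOn (fun w : ℝ => w ^ (-η - 1)) (Set.Ioi c) :=
    integrableOn_Ioi_rpow_of_lt (by linarith) hc
  rw [← ofReal_integral_eq_lintegral_ofReal hint, integral_Ioi_rpow_of_lt (by linarith) hc,
    sub_add_cancel, neg_div_neg_eq]
  filter_upwards [ae_restrict_mem measurableSet_Ioi] with w hw
  exact Real.rpow_nonneg (hc.trans hw).le _

theorem inv_mul_mul_rpow {b w : ℝ} (hb : 0 ≤ b) (hw : 0 < w) (p : ℝ) :
    w⁻¹ * (b * w) ^ p = b ^ p * w ^ (p - 1) := by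
  rw [Real.rpow_sub_one hw.ne', Real.mul_rpow hb hw.le]
  ring

theorem lintegral_Ioc_inv_mul_mul_rpow {b η : ℝ} (hb : 0 < b) (hη : 0 < η) :
    ∫⁻ w in Set.Ioc 0 b⁻¹, ENNReal.ofReal (w⁻¹ * (b * w) ^ η) = ENNReal.ofReal (1 / η) := by
  have hb' : 0 < b⁻¹ := inv_pos.mpr hb
  rw [setLIntegral_congr_fun measurableSet_Ioc fun w hw =>
      (congrArg ENNReal.ofReal (inv_mul_mul_rpow hb.le hw.1 η)).trans
        (ENNReal.ofReal_mul (by positivity)),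
    lintegral_const_mul _ (by fun_prop), lintegral_Ioc_rpow_sub_one hb'.le hη,
    ← ENNReal.ofReal_mul (by positivity), ← mul_div_assoc, ← Real.mul_rpow hb.le hb'.le,
    mul_inv_cancel₀ hb.ne', Real.one_rpow]

theorem lintegral_Ioi_inv_mul_mul_rpow_neg {b η : ℝ} (hb : 0 < b) (hη : 0 < η) :
    ∫⁻ w in Set.Ioi b⁻¹, ENNReal.ofReal (w⁻¹ * (b * w) ^ (-η)) = ENNReal.ofReal (1 / η) := by
  have hb' : 0 < b⁻¹ := inv_pos.mpr hb
  rw [setLIntegral_congr_fun measurableSet_Ioi fun w hw =>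
      (congrArg ENNReal.ofReal (inv_mul_mul_rpow hb.le (hb'.trans hw) (-η))).trans
        (ENNReal.ofReal_mul (by positivity)),
    lintegral_const_mul _ (by fun_prop), lintegral_Ioi_rpow_neg_sub_one hb' hη,
    ← ENNReal.ofReal_mul (by positivity), ← mul_div_assoc, ← Real.mul_rpow hb.le hb'.le,
    mul_inv_cancel₀ hb.ne', Real.one_rpow]

theorem lintegral_Ioi_inv_mul_min_rpow_le {b η : ℝ} (hb : 0 < b) (hη : 0 < η) :
    ∫⁻ w in Set.Ioi 0, ENNReal.ofReal (w⁻¹ * min ((b * w) ^ (-η)) ((b * w) ^ η)) ≤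
      ENNReal.ofReal (2 / η) := by
  have hb' : 0 < b⁻¹ := inv_pos.mpr hb
  let g : ℝ → ENNReal := fun w => ENNReal.ofReal (w⁻¹ * min ((b * w) ^ (-η)) ((b * w) ^ η))
  calc ∫⁻ w in Set.Ioi 0, g w ≤ (∫⁻ w in Set.Ioc 0 b⁻¹, g w) + ∫⁻ w in Set.Ioi b⁻¹, g w := by
        rw [← Set.Ioc_union_Ioi_eq_Ioi hb'.le]
        exact lintegral_union_le _ _ _
    _ ≤ (∫⁻ w in Set.Ioc 0 b⁻¹, ENNReal.ofReal (w⁻¹ * (b * w) ^ η)) +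
        ∫⁻ w in Set.Ioi b⁻¹, ENNReal.ofReal (w⁻¹ * (b * w) ^ (-η)) :=
      add_le_add
        (setLIntegral_mono (by fun_prop) fun w hw => ENNReal.ofReal_le_ofReal
          (mul_le_mul_of_nonneg_left (min_le_right _ _) (inv_nonneg.mpr hw.1.le)))
        (setLIntegral_mono (by fun_prop) fun w hw => ENNReal.ofReal_le_ofReal
          (mul_le_mul_of_nonneg_left (min_le_left _ _) (inv_nonneg.mpr (hb'.trans hw).le)))
    _ = ENNReal.ofReal (2 / η) := by
      rw [lintegral_Ioc_inv_mul_mul_rpow hb hη, lintegral_Ioi_inv_mul_mul_rpow_neg hb hη,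
        ← ENNReal.ofReal_add (by positivity) (by positivity), ← add_div, one_add_one_eq_two]

theorem paretoPDF_le {w₀ r s w : ℝ} (hw₀ : 0 < w₀) (hs : s ≤ r) (hr : 0 ≤ r) :
    paretoPDF w₀ r w ≤
      (Set.Ioi 0).indicator (fun w => ENNReal.ofReal (r * w₀ ^ s * w ^ (-(s + 1)))) w := by
  rcases lt_or_ge w w₀ with hw | hw
  · simp [paretoPDF_of_lt hw]
  have hw' : 0 < w := hw₀.trans_le hw
  rw [paretoPDF_of_le hw, Set.indicator_of_mem (Set.mem_Ioi.mpr hw')]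
  refine ENNReal.ofReal_le_ofReal ?_
  have hratio : w₀ ^ (r - s) ≤ w ^ (r - s) := by gcongr
  calc r * w₀ ^ r * w ^ (-(r + 1)) = r * w₀ ^ s * (w ^ (-(r + 1)) * w₀ ^ (r - s)) := by
        nth_rw 2 [← add_sub_cancel s r]
        rw [Real.rpow_add hw₀]
        ring
    _ ≤ r * w₀ ^ s * (w ^ (-(r + 1)) * w ^ (r - s)) := by gcongr
    _ = r * w₀ ^ s * w ^ (-(s + 1)) := by
      rw [← Real.rpow_add hw']
      ring_nf

theorem lintegral_paretoMeasure_min_rpow_le {w₀ r s b η : ℝ} (hw₀ : 0 < w₀) (hr : 0 ≤ r)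
    (hs : s ≤ r) (hb : 0 < b) (hη : 0 < η) :
    ∫⁻ w, ENNReal.ofReal (min ((b * w) ^ (s - η)) ((b * w) ^ (s + η))) ∂paretoMeasure w₀ r ≤
      ENNReal.ofReal (2 * r / η * (b * w₀) ^ s) := by
  have hpoint (w : ℝ) (hw : 0 < w) :
      r * w₀ ^ s * w ^ (-(s + 1)) * min ((b * w) ^ (s - η)) ((b * w) ^ (s + η)) =
        r * (b * w₀) ^ s * (w⁻¹ * min ((b * w) ^ (-η)) ((b * w) ^ η)) := by
    have hbw : 0 < b * w := mul_pos hb hw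
    rw [sub_eq_add_neg, Real.rpow_add hbw, Real.rpow_add hbw, ← mul_min_of_nonneg _ _
      (by positivity), Real.mul_rpow hb.le hw.le, Real.mul_rpow hb.le hw₀.le, neg_add,
      Real.rpow_add hw, Real.rpow_neg hw.le, Real.rpow_neg_one]
    field_simp
  have hpdf : Measurable (paretoPDF w₀ r) := (measurable_paretoPDFReal w₀ r).ennreal_ofReal
  rw [paretoMeasure, lintegral_withDensity_eq_lintegral_mul _ hpdf (by fun_prop)]
  calc _ ≤ ∫⁻ w in Set.Ioi 0, ENNReal.ofReal (r * (b * w₀) ^ s) *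
        ENNReal.ofReal (w⁻¹ * min ((b * w) ^ (-η)) ((b * w) ^ η)) := by
        rw [← lintegral_indicator measurableSet_Ioi]
        refine lintegral_mono fun w => ?_
        rw [Pi.mul_apply]
        refine (mul_le_mul_left (paretoPDF_le hw₀ hs hr) _).trans ?_
        by_cases hw : 0 < w
        · rw [Set.indicator_of_mem (Set.mem_Ioi.mpr hw), Set.indicator_of_mem (Set.mem_Ioi.mpr hw),
            ← ENNReal.ofReal_mul (by positivity), ← ENNReal.ofReal_mul (by positivity),
            hpoint w hw]
        · simp [hw]
    _ ≤ ENNReal.ofReal (r * (b * w₀) ^ s) * ENNReal.ofReal (2 / η) := by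
      rw [lintegral_const_mul _ (by fun_prop)]
      gcongr
      exact lintegral_Ioi_inv_mul_min_rpow_le hb hη
    _ = ENNReal.ofReal (2 * r / η * (b * w₀) ^ s) := by
      rw [← ENNReal.ofReal_mul (by positivity)]
      ring_nf

theorem ae_le_paretoMeasure (w₀ r : ℝ) : ∀ᵐ w ∂paretoMeasure w₀ r, w₀ ≤ w := by
  rw [ae_iff]
  simp only [not_le]
  change paretoMeasure w₀ r (Set.Iio w₀) = 0
  rw [paretoMeasure, withDensity_apply _ measurableSet_Iio]
  exact lintegral_paretoPDF_of_le le_rfl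

end Pareto

/-- The event that `k` vertex samples are pairwise within the connection threshold of a graph on
`n` vertices, i.e. that distinct vertices carrying these samples form a clique. -/
def cliqueEvent (n k d : ℕ) (lam : ℝ) : Set (Fin k → VertexSample d) :=
  {x | ∀ e ∈ edgePairs k,
    dist (x e.1).2 (x e.2).2 ≤ connectionThreshold n d lam (x e.1).1 (x e.2).1}

theorem measurableSet_cliqueEvent (n k d : ℕ) (lam : ℝ) :
    MeasurableSet (cliqueEvent n k d lam) := by
  have hinter : cliqueEvent n k d lam = ⋂ e ∈ edgePairs k,
      {x | dist (x e.1).2 (x e.2).2 ≤ connectionThreshold n d lam (x e.1).1 (x e.2).1} := by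
    ext x
    simp [cliqueEvent]
  rw [hinter]
  refine Finset.measurableSet_biInter _ fun e _ => measurableSet_le ?_ ?_
  · exact (measurable_pi_apply e.1).snd.dist (measurable_pi_apply e.2).snd
  · unfold connectionThreshold
    fun_prop

theorem volume_pi_forall_dist_le_connectionThreshold_le {lam w₀ δ η : ℝ} {n d : ℕ}
    (hlam : 0 < lam) (hw₀ : 0 < w₀) (hn : n ≠ 0) (hd : d ≠ 0) (hδ : 0 ≤ δ) (hη : 0 ≤ η)
    (hδη : (2 / 3 + η) * (1 + 7 * δ) ≤ 1) (hnd : -Real.log (lam * w₀ ^ 2 / n) ≤ δ * d)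
    {w : Fin 4 → ℝ} (hw : ∀ i, w₀ ≤ w i) :
    volume {x : Fin 4 → UnitAddTorus (Fin d) | ∀ e ∈ edgePairs 4,
        dist (x e.1) (x e.2) ≤ connectionThreshold n d lam (w e.1) (w e.2)} ≤
      ∏ i, ENNReal.ofReal (min ((√(lam / n) * w i) ^ (2 - η)) ((√(lam / n) * w i) ^ (2 + η))) := by
  have hw' (i) : 0 < w i := hw₀.trans_le (hw i)
  have hu (i) : 0 < √(lam / n) * w i := mul_pos (Real.sqrt_pos.mpr (by positivity)) (hw' i)
  have hκ (e : Fin 4 × Fin 4) :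
      lam * w e.1 * w e.2 / n = (√(lam / n) * w e.1) * (√(lam / n) * w e.2) := by
    rw [mul_mul_mul_comm, Real.mul_self_sqrt (by positivity)]
    ring
  have hκδ (e : Fin 4 × Fin 4) : -Real.log (lam * w e.1 * w e.2 / n) ≤ δ * d := by
    refine (neg_le_neg (Real.log_le_log (by positivity) ?_)).trans hnd
    rw [sq, ← mul_assoc]
    have := hw' e.1
    gcongr <;> exact hw _
  refine (volume_pi_forall_dist_le_half_rpow_le (γ := 2 / 3 + η) hd (fun e => mem_edgePairs.mp)
    (fun e _ => ?_) hδ (fun e _ => hκδ e) ?_).trans ?_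
  · rw [hκ]
    exact mul_pos (hu _) (hu _)
  · have hcard : (edgePairs 4).card = 6 := by decide
    rw [hcard]
    norm_num1
    linarith
  · rw [← ENNReal.ofReal_prod_of_nonneg fun i _ => by have := hu i; positivity]
    simp only [hκ]
    exact ENNReal.ofReal_le_ofReal
      (prod_edgePairs_four_min_one_rpow_le hη (by nlinarith) hu)

theorem isProbabilityMeasure_vertexLaw {β w₀ : ℝ} (hβ : 1 < β) (hw₀ : 0 < w₀) (d : ℕ) :
    IsProbabilityMeasure (vertexLaw β w₀ d) := by
  have := isProbabilityMeasure_paretoMeasure hw₀ (sub_pos.mpr hβ)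
  unfold vertexLaw
  infer_instance

theorem sampleLaw_cliqueEvent_eq_lintegral (n k d : ℕ) (lam : ℝ) {β w₀ : ℝ} (hβ : 1 < β)
    (hw₀ : 0 < w₀) :
    sampleLaw k β w₀ d (cliqueEvent n k d lam) =
      ∫⁻ w, volume {x : Fin k → UnitAddTorus (Fin d) | ∀ e ∈ edgePairs k,
        dist (x e.1) (x e.2) ≤ connectionThreshold n d lam (w e.1) (w e.2)}
        ∂(Measure.pi fun _ => paretoMeasure w₀ (β - 1)) := by
  have := isProbabilityMeasure_paretoMeasure hw₀ (sub_pos.mpr hβ)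
  have hmp := measurePreserving_arrowProdEquivProdArrow ℝ (UnitAddTorus (Fin d)) (Fin k)
    (fun _ => paretoMeasure w₀ (β - 1)) (fun _ => volume)
  have hA := (measurableSet_cliqueEvent n k d lam).preimage
    (MeasurableEquiv.arrowProdEquivProdArrow ℝ (UnitAddTorus (Fin d)) (Fin k)).symm.measurable
  have h := hmp.symm.measure_preimage (measurableSet_cliqueEvent n k d lam).nullMeasurableSet
  rw [sampleLaw, vertexLaw]
  refine h.symm.trans ?_
  rw [Measure.prod_apply hA]
  rfl

theorem sampleLaw_cliqueEvent_four_le {β lam w₀ δ η : ℝ} {n d : ℕ} (hβ : 3 ≤ β)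
    (hlam : 0 < lam) (hw₀ : 0 < w₀) (hn : n ≠ 0) (hd : d ≠ 0) (hδ : 0 ≤ δ) (hη : 0 < η)
    (hδη : (2 / 3 + η) * (1 + 7 * δ) ≤ 1) (hnd : -Real.log (lam * w₀ ^ 2 / n) ≤ δ * d) :
    sampleLaw 4 β w₀ d (cliqueEvent n 4 d lam) ≤
      ENNReal.ofReal (2 * (β - 1) / η * (lam * w₀ ^ 2) / n) ^ 4 := by
  have := isProbabilityMeasure_paretoMeasure (r := β - 1) hw₀ (by linarith)
  have hweights : ∀ᵐ w ∂(Measure.pi fun _ : Fin 4 => paretoMeasure w₀ (β - 1)), ∀ i, w₀ ≤ w i :=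
    ae_all_iff.mpr fun i => (measurePreserving_eval (fun _ : Fin 4 => paretoMeasure w₀ (β - 1))
      i).quasiMeasurePreserving.ae (ae_le_paretoMeasure w₀ (β - 1))
  have hscale : (√(lam / n) * w₀) ^ (2 : ℝ) = lam * w₀ ^ 2 / n := by
    rw [Real.rpow_two, mul_pow, Real.sq_sqrt (by positivity)]
    ring
  let g : ℝ → ENNReal := fun w =>
    ENNReal.ofReal (min ((√(lam / n) * w) ^ (2 - η)) ((√(lam / n) * w) ^ (2 + η)))
  calc sampleLaw 4 β w₀ d (cliqueEvent n 4 d lam)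
      ≤ ∫⁻ w, ∏ i, g (w i) ∂(Measure.pi fun _ : Fin 4 => paretoMeasure w₀ (β - 1)) := by
        rw [sampleLaw_cliqueEvent_eq_lintegral n 4 d lam (by linarith) hw₀]
        refine lintegral_mono_ae ?_
        filter_upwards [hweights] with w hw
        exact volume_pi_forall_dist_le_connectionThreshold_le hlam hw₀ hn hd hδ hη.le hδη hnd hw
    _ = (∫⁻ w, g w ∂paretoMeasure w₀ (β - 1)) ^ 4 := by
      rw [lintegral_pi_prod_eq_pow_card _ (by fun_prop), Fintype.card_fin]
    _ ≤ ENNReal.ofReal (2 * (β - 1) / η * (lam * w₀ ^ 2) / n) ^ 4 := by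
      rw [mul_div_assoc, ← hscale]
      gcongr
      exact lintegral_paretoMeasure_min_rpow_le hw₀ (by linarith) (by linarith)
        (Real.sqrt_pos.mpr (by positivity)) hη

theorem isNClique_girg_iff {n k d : ℕ} {lam : ℝ} {x : Fin n → VertexSample d}
    {s : Set.powersetCard (Fin n) k} :
    (girg n d lam x).IsNClique k s ↔
      x ∘ Set.powersetCard.ofFinEmbEquiv.symm s ∈ cliqueEvent n k d lam := by
  obtain ⟨e, rfl⟩ := Set.powersetCard.ofFinEmbEquiv.surjective s
  have hrange : ((Set.powersetCard.ofFinEmbEquiv e : Finset (Fin n)) : Set (Fin n)) =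
      Set.range e := by
    ext v
    exact Set.powersetCard.mem_ofFinEmbEquiv_iff_mem_range e v
  rw [SimpleGraph.isNClique_iff, and_iff_left (Set.powersetCard.card_eq _), hrange,
    SimpleGraph.isClique_iff, Equiv.symm_apply_apply]
  constructor
  · intro hclique p hp
    exact (hclique (Set.mem_range_self p.1) (Set.mem_range_self p.2)
      (e.injective.ne (mem_edgePairs.mp hp).ne)).2
  · rintro hmem _ ⟨i, rfl⟩ _ ⟨j, rfl⟩ hij
    rcases lt_or_gt_of_ne (ne_of_apply_ne e hij) with h | h
    · exact ⟨hij, hmem (i, j) (mem_edgePairs.mpr h)⟩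
    · exact SimpleGraph.Adj.symm ⟨hij.symm, hmem (j, i) (mem_edgePairs.mpr h)⟩

theorem cliqueCount_girg_eq_sum_indicator {R : Type*} [AddCommMonoidWithOne R] (n k d : ℕ)
    (lam : ℝ) (x : Fin n → VertexSample d) :
    (cliqueCount (girg n d lam x) k : R) = ∑ s : Set.powersetCard (Fin n) k,
      (cliqueEvent n k d lam).indicator 1 (x ∘ Set.powersetCard.ofFinEmbEquiv.symm s) := by
  classical
  have himage : (girg n d lam x).cliqueSet k = Subtype.val '' {s : Set.powersetCard (Fin n) k |
      x ∘ Set.powersetCard.ofFinEmbEquiv.symm s ∈ cliqueEvent n k d lam} := by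
    ext s
    simp only [SimpleGraph.mem_cliqueSet_iff, Set.mem_image, Set.mem_ofPred_eq]
    constructor
    · exact fun hs => ⟨⟨s, hs.card_eq⟩, isNClique_girg_iff.mp hs, rfl⟩
    · rintro ⟨t, ht, rfl⟩
      exact isNClique_girg_iff.mpr ht
  rw [cliqueCount, himage, Set.ncard_image_of_injective _ Subtype.val_injective,
    Set.ncard_eq_toFinset_card', Set.toFinset_ofPred, Finset.natCast_card_filter]
  simp only [Set.indicator_apply, Pi.one_apply]

theorem measurable_cliqueCount_girg (n k d : ℕ) (lam : ℝ) :
    Measurable fun x : Fin n → VertexSample d => cliqueCount (girg n d lam x) k := by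
  have hsum := cliqueCount_girg_eq_sum_indicator (R := ℕ) n k d lam
  simp only [Nat.cast_id] at hsum
  simp only [hsum]
  exact Finset.measurable_sum _ fun s _ =>
    (measurable_one.indicator (measurableSet_cliqueEvent n k d lam)).comp (by fun_prop)

theorem lintegral_cliqueCount_girg (n k d : ℕ) (lam : ℝ) {β w₀ : ℝ} (hβ : 1 < β)
    (hw₀ : 0 < w₀) :
    ∫⁻ x, cliqueCount (girg n d lam x) k ∂sampleLaw n β w₀ d =
      n.choose k * sampleLaw k β w₀ d (cliqueEvent n k d lam) := by
  have := isProbabilityMeasure_vertexLaw hβ hw₀ d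
  have hE := measurableSet_cliqueEvent n k d lam
  have hmp (s : Set.powersetCard (Fin n) k) : MeasurePreserving
      (· ∘ Set.powersetCard.ofFinEmbEquiv.symm s) (sampleLaw n β w₀ d) (sampleLaw k β w₀ d) :=
    measurePreserving_pi_precomp _ (Set.powersetCard.ofFinEmbEquiv.symm s).injective
  have hind : Measurable
      ((cliqueEvent n k d lam).indicator (1 : (Fin k → VertexSample d) → ENNReal)) :=
    measurable_one.indicator hE
  have hmeas (s : Set.powersetCard (Fin n) k) : Measurable fun x : Fin n → VertexSample d =>
      (cliqueEvent n k d lam).indicator (1 : (Fin k → VertexSample d) → ENNReal)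
        (x ∘ Set.powersetCard.ofFinEmbEquiv.symm s) :=
    hind.comp (hmp s).measurable
  have hclique (s : Set.powersetCard (Fin n) k) :
      ∫⁻ x, (cliqueEvent n k d lam).indicator 1 (x ∘ Set.powersetCard.ofFinEmbEquiv.symm s)
        ∂sampleLaw n β w₀ d = sampleLaw k β w₀ d (cliqueEvent n k d lam) := by
    rw [(hmp s).lintegral_comp hind, lintegral_indicator_one hE]
  simp only [cliqueCount_girg_eq_sum_indicator]
  rw [lintegral_finsetSum Finset.univ fun s _ => hmeas s,
    Finset.sum_congr rfl fun s _ => hclique s, Finset.sum_const, Finset.card_univ,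
    ← Nat.card_eq_fintype_card, Set.powersetCard.card, Nat.card_eq_fintype_card, Fintype.card_fin,
    nsmul_eq_mul]

theorem lintegral_cliqueCount_girg_four_le {β lam w₀ δ η : ℝ} {n d : ℕ} (hβ : 3 ≤ β)
    (hlam : 0 < lam) (hw₀ : 0 < w₀) (hn : n ≠ 0) (hd : d ≠ 0) (hδ : 0 ≤ δ) (hη : 0 < η)
    (hδη : (2 / 3 + η) * (1 + 7 * δ) ≤ 1) (hnd : -Real.log (lam * w₀ ^ 2 / n) ≤ δ * d) :
    ∫⁻ x, cliqueCount (girg n d lam x) 4 ∂sampleLaw n β w₀ d ≤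
      ENNReal.ofReal (2 * (β - 1) / η * (lam * w₀ ^ 2)) ^ 4 := by
  have hn' : (0 : ℝ) < n := by positivity
  rw [lintegral_cliqueCount_girg n 4 d lam (by linarith) hw₀]
  calc (n.choose 4 : ENNReal) * sampleLaw 4 β w₀ d (cliqueEvent n 4 d lam)
      ≤ (n : ENNReal) ^ 4 * ENNReal.ofReal (2 * (β - 1) / η * (lam * w₀ ^ 2) / n) ^ 4 := by
        gcongr
        · exact_mod_cast Nat.choose_le_pow n 4
        · exact sampleLaw_cliqueEvent_four_le hβ hlam hw₀ hn hd hδ hη hδη hnd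
    _ = ENNReal.ofReal (2 * (β - 1) / η * (lam * w₀ ^ 2)) ^ 4 := by
      rw [← mul_pow, ← ENNReal.ofReal_natCast, ← ENNReal.ofReal_mul hn'.le,
        mul_div_cancel₀ _ hn'.ne']

/-- A sequence of `ℕ`-valued random variables, on probability spaces that may vary along the
sequence, is bounded in probability: its laws form a tight sequence. -/
def BoundedInProbability {Ω : ℕ → Type*} [∀ n, MeasurableSpace (Ω n)] (μ : ∀ n, Measure (Ω n))
    (X : ∀ n, Ω n → ℕ) : Prop :=
  ∀ ε : ℝ, 0 < ε → ∃ c : ℕ, ∀ n : ℕ, μ n {ω | c ≤ X n ω} ≤ ENNReal.ofReal ε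

namespace BoundedInProbability

variable {Ω : ℕ → Type*} [∀ n, MeasurableSpace (Ω n)] {μ : ∀ n, Measure (Ω n)}
  {X Y : ∀ n, Ω n → ℕ}

theorem of_eventually_lintegral_le {B : ℕ → ℕ} (hX : ∀ n, Measurable (X n))
    (hB : ∀ n ω, X n ω ≤ B n) {M : ENNReal} (hM : M ≠ ⊤)
    (hmean : ∀ᶠ n in atTop, ∫⁻ ω, X n ω ∂μ n ≤ M) : BoundedInProbability μ X := by
  intro ε hε
  have hε' : ENNReal.ofReal ε ≠ 0 := (ENNReal.ofReal_pos.mpr hε).ne'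
  obtain ⟨N, hN⟩ := eventually_atTop.mp hmean
  obtain ⟨m, hm⟩ := ENNReal.exists_nat_gt (ENNReal.div_ne_top hM hε')
  obtain ⟨K, hK⟩ := ((Finset.range N).image B).bddAbove
  refine ⟨m + K + 1, fun n => ?_⟩
  rcases lt_or_ge n N with hn | hn
  · have hBK : B n ≤ K := hK (by exact Finset.mem_image_of_mem B (Finset.mem_range.mpr hn))
    have hempty : {ω | m + K + 1 ≤ X n ω} = ∅ := Set.eq_empty_of_forall_notMem fun ω hω => by
      have : m + K + 1 ≤ X n ω := hω
      have := hB n ω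
      omega
    rw [hempty, measure_empty]
    exact zero_le
  · calc μ n {ω | m + K + 1 ≤ X n ω} ≤ μ n {ω | (m : ENNReal) ≤ X n ω} :=
          measure_mono fun ω (hω : m + K + 1 ≤ X n ω) => by
            have hmX : m ≤ X n ω := by omega
            simpa using hmX
      _ ≤ (∫⁻ ω, X n ω ∂μ n) / m :=
        meas_ge_le_lintegral_div (measurable_from_top.comp (hX n)).aemeasurable
          (pos_of_gt hm).ne' (ENNReal.natCast_ne_top m)
      _ ≤ M / m := by gcongr; exact hN n hn
      _ ≤ ENNReal.ofReal ε := ENNReal.div_le_of_le_mul'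
        (((ENNReal.div_le_iff_le_mul (Or.inl hε') (Or.inl ENNReal.ofReal_ne_top)).mp hm.le))

theorem of_le_add (hX : BoundedInProbability μ X) {k : ℕ} (hXY : ∀ n ω, Y n ω ≤ X n ω + k) :
    BoundedInProbability μ Y := by
  intro ε hε
  obtain ⟨c, hc⟩ := hX ε hε
  refine ⟨c + k, fun n => (measure_mono fun ω hω => ?_).trans (hc n)⟩
  exact Nat.le_of_add_le_add_right (hω.trans (hXY n ω))

theorem tendsto_measure_ge (hX : BoundedInProbability μ X) {f : ℕ → ℝ}
    (hf : Tendsto f atTop atTop) :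
    Tendsto (fun n => μ n {ω | f n ≤ X n ω}) atTop (𝓝 0) := by
  refine ENNReal.tendsto_nhds_zero.mpr fun ε hε => ?_
  obtain ⟨δ, hδ, hδε⟩ := ENNReal.lt_iff_exists_nnreal_btwn.mp hε
  obtain ⟨c, hc⟩ := hX δ (by exact_mod_cast hδ)
  filter_upwards [hf.eventually_ge_atTop (c : ℝ)] with n hn
  calc μ n {ω | f n ≤ X n ω} ≤ μ n {ω | c ≤ X n ω} :=
        measure_mono fun ω hω => Nat.cast_le.mp (hn.trans hω)
    _ ≤ δ := by simpa using hc n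
    _ ≤ ε := hδε.le

end BoundedInProbability

theorem cliqueCount_le_two_pow_card {V : Type*} [Fintype V] (G : SimpleGraph V) (k : ℕ) :
    cliqueCount G k ≤ 2 ^ Fintype.card V := by
  rw [← Fintype.card_finset, ← Nat.card_eq_fintype_card]
  exact Set.ncard_le_card _

theorem le_choose_succ_add (m k : ℕ) : m ≤ m.choose (k + 1) + k := by
  induction m with
  | zero => simp
  | succ m ih =>
    rcases le_or_gt k m with hkm | hkm
    · have := Nat.choose_pos hkm
      rw [Nat.choose_succ_succ']
      omega
    · omega

theorem cliqueNum_le_cliqueCount_succ_add {V : Type*} [Finite V] (G : SimpleGraph V) (k : ℕ) :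
    G.cliqueNum ≤ cliqueCount G (k + 1) + k := by
  obtain ⟨s, hs⟩ := G.exists_isNClique_cliqueNum
  have hsub : (s.powersetCard (k + 1) : Set (Finset V)) ⊆ G.cliqueSet (k + 1) := by
    intro t ht
    rw [Finset.mem_coe, Finset.mem_powersetCard] at ht
    exact ⟨hs.isClique.subset (Finset.coe_subset.mpr ht.1), ht.2⟩
  have hcard := Set.ncard_le_ncard hsub (Set.toFinite _)
  rw [Set.ncard_coe_finset, Finset.card_powersetCard, hs.card_eq] at hcard
  exact (le_choose_succ_add _ k).trans (Nat.add_le_add_right hcard k)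

theorem eventually_mul_le_of_log_isLittleO {d : ℕ → ℕ}
    (hd : (fun n : ℕ => Real.log n) =o[atTop] fun n : ℕ => (d n : ℝ)) {C : ℝ} (hC : 0 < C) :
    ∀ᶠ n : ℕ in atTop, C * Real.log n ≤ d n := by
  filter_upwards [hd.bound (inv_pos.mpr hC)] with n hn
  rwa [Real.norm_of_nonneg (Real.log_natCast_nonneg n), Real.norm_natCast, inv_mul_eq_div,
    le_div_iff₀' hC] at hn

theorem eventually_neg_log_div_le {d : ℕ → ℕ} {a C δ : ℝ} (ha : 0 < a) (hδ : 0 < δ)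
    (hCδ : 1 < C * δ) (hd : ∀ᶠ n : ℕ in atTop, C * Real.log n ≤ d n) :
    ∀ᶠ n : ℕ in atTop, n ≠ 0 ∧ d n ≠ 0 ∧ -Real.log (a / n) ≤ δ * d n := by
  have hlog : Tendsto (fun n : ℕ => Real.log n) atTop atTop :=
    Real.tendsto_log_atTop.comp tendsto_natCast_atTop_atTop
  filter_upwards [hd, eventually_ne_atTop 0, hlog.eventually_gt_atTop 0,
    (hlog.const_mul_atTop (sub_pos.mpr hCδ)).eventually_ge_atTop (-Real.log a)]
    with n hdn hn hpos hge
  have hδd : C * δ * Real.log n ≤ δ * d n := by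
    rw [mul_comm C, mul_assoc]
    gcongr
  refine ⟨hn, fun hd0 => ?_, ?_⟩
  · rw [hd0, Nat.cast_zero, mul_zero] at hδd
    exact hδd.not_gt (mul_pos (one_pos.trans hCδ) hpos)
  · rw [Real.log_div ha.ne' (by positivity)]
    linarith

theorem boundedInProbability_cliqueCount_girg_four {β lam w₀ C : ℝ} (hβ : 3 ≤ β) (hlam : 0 < lam)
    (hw₀ : 0 < w₀) (hC : 14 < C) {d : ℕ → ℕ}
    (hd : ∀ᶠ n : ℕ in atTop, C * Real.log n ≤ d n) :
    BoundedInProbability (fun n => sampleLaw n β w₀ (d n))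
      fun n x => cliqueCount (girg n (d n) lam x) 4 := by
  obtain ⟨δ, hCδ, hδ⟩ : ∃ δ, C⁻¹ < δ ∧ δ < 14⁻¹ :=
    exists_between (inv_strictAnti₀ (by norm_num) hC)
  have hδ₀ : 0 < δ := lt_trans (by positivity) hCδ
  let η := (1 + 7 * δ)⁻¹ - 2 / 3
  have hη : 0 < η := by
    rw [sub_pos, lt_inv_comm₀ (by norm_num) (by positivity)]
    linarith
  have hδη : (2 / 3 + η) * (1 + 7 * δ) ≤ 1 := by
    rw [add_sub_cancel, inv_mul_cancel₀ (by positivity)]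
  refine .of_eventually_lintegral_le (B := fun n => 2 ^ n)
    (M := ENNReal.ofReal (2 * (β - 1) / η * (lam * w₀ ^ 2)) ^ 4)
    (fun n => measurable_cliqueCount_girg n 4 (d n) lam) (fun n x => ?_)
    (ENNReal.pow_ne_top ENNReal.ofReal_ne_top) ?_
  · simpa using cliqueCount_le_two_pow_card (girg n (d n) lam x) 4
  · filter_upwards [eventually_neg_log_div_le (a := lam * w₀ ^ 2) (by positivity) hδ₀
      ((inv_lt_iff_one_lt_mul₀' (by linarith)).mp hCδ) hd] with n ⟨hn, hdn, hnd⟩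
    exact lintegral_cliqueCount_girg_four_le hβ hlam hw₀ hn hdn hδ₀.le hη hδη hnd

theorem mainTheorem7_general {β lam w₀ C : ℝ} (hβ : 3 ≤ β) (hlam : 0 < lam) (hw₀ : 0 < w₀)
    (hC : 14 < C) {d : ℕ → ℕ} (hd : ∀ᶠ n : ℕ in atTop, C * Real.log n ≤ d n) :
    BoundedInProbability (fun n => sampleLaw n β w₀ (d n))
        (fun n x => cliqueCount (girg n (d n) lam x) 4) ∧
      BoundedInProbability (fun n => sampleLaw n β w₀ (d n))
        (fun n x => (girg n (d n) lam x).cliqueNum) ∧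
      ∀ f : ℕ → ℝ, Tendsto f atTop atTop →
        Tendsto (fun n : ℕ =>
            sampleLaw n β w₀ (d n) {x | f n ≤ ((girg n (d n) lam x).cliqueNum : ℝ)})
          atTop (𝓝 0) := by
  have hcount := boundedInProbability_cliqueCount_girg_four hβ hlam hw₀ hC hd
  have hnum := hcount.of_le_add fun n x => cliqueNum_le_cliqueCount_succ_add (girg n (d n) lam x) 3
  exact ⟨hcount, hnum, fun f hf => hnum.tendsto_measure_ge hf⟩

theorem mainTheorem7 (lam w₀ : ℝ) (hlam : 0 < lam) (hw₀ : 0 < w₀)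
    (d : ℕ → ℕ) (hd : (fun n : ℕ => Real.log n) =o[atTop] fun n : ℕ => (d n : ℝ)) :
    -- the number of 4-cliques is bounded in probability
    (∀ ε : ℝ, 0 < ε → ∃ c : ℕ, ∀ n : ℕ,
      sampleLaw n 3 w₀ (d n) {x | c ≤ cliqueCount (girg n (d n) lam x) 4} ≤ ENNReal.ofReal ε) ∧
    -- the clique number is bounded in probability
    (∀ ε : ℝ, 0 < ε → ∃ c : ℕ, ∀ n : ℕ,
      sampleLaw n 3 w₀ (d n) {x | c ≤ (girg n (d n) lam x).cliqueNum} ≤ ENNReal.ofReal ε) ∧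
    -- a.a.s. the clique number stays below any given function that tends to infinity
    (∀ f : ℕ → ℝ, Tendsto f atTop atTop →
      Tendsto (fun n : ℕ =>
          sampleLaw n 3 w₀ (d n) {x | f n ≤ ((girg n (d n) lam x).cliqueNum : ℝ)})
        atTop (𝓝 0)) :=
  mainTheorem7_general le_rfl hlam hw₀ (by norm_num : (14 : ℝ) < 15)
    (eventually_mul_le_of_log_isLittleO hd (by norm_num))
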